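/- Let $M$ be a Euclidean space of finite dimension $d\ge 1$, with momentum space $M^*\cong M$ through the inner product, and let $d\nu=(2\pi)^{-d/2}dx$ on both, so that $\widetilde\phi(p)=\int_M \phi(x)e^{-i(p,x)}\,d\nu(x)$. Let $k:M^*\to\mathbb R$ be even and almost everywhere positive, with $1/k$ locally integrable, and consider the free action $$S_{free}(\phi)=\int_{M^*}k(p)\,\widetilde\phi(p)\widetilde\phi(-p)\,d\nu(p),$$ whose propagator (the kernel of the inverse form) has Fourier transform $1/k$. For $0\le\Lambda\le\Lambda'$ let $I_{\Lambda'\setminus\Lambda}=\{p:\Lambda^2\le p^2\le\Lambda'^2\}$ and let $$K_{|\Lambda'\setminus\Lambda}(x,y)=\int_{I_{\Lambda'\setminus\Lambda}}k(p)^{-1}e^{i(p,x-y)}\,d\nu(p)$$ be the sharply regularized propagator. Write $S_{free|\Lambda'\setminus\Lambda}$ for the corresponding regularized action, that is, the one with inverse form $(f,g)\mapsto\iint K_{|\Lambda'\setminus\Lambda}(x,y)f(x)g(y)\,d\nu(x)d\nu(y)$. The sharply regularized free measure $\mu_{free|\Lambda'\setminus\Lambda}=e^{-S_{free|\Lambda'\setminus\Lambda}(\phi)}D\phi$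 (normalized to total mass one) is understood as the centred Gaussian measure on the space of real tempered distributions $\phi\in\mathcal S'(M)$, with the $\sigma$-algebra generated by the evaluations $\phi\mapsto\phi(f)$, $f\in\mathcal S(M,\mathbb R)$. It is thus the probability measure with characteristic functional $$\int e^{i\phi(f)}\,d\mu_{free|\Lambda'\setminus\Lambda}(\phi)=\exp\Big(-\tfrac14\iint K_{|\Lambda'\setminus\Lambda}(x,y)f(x)f(y)\,d\nu(x)d\nu(y)\Big),\qquad f\in\mathcal S(M,\mathbb R).$$ (The factor $\tfrac14$ corresponds to the weight $e^{-S}$ rather than $e^{-S/2}$.) Put $\mu_{free|\Lambda}=\mu_{free|\Lambda\setminus 0}$. Proposition. For all $0\le\Lambda\le\Lambda'$ the measure $\mu_{free|\Lambda'\setminus\Lambda}$ exists and is unique, and $$\mu_{free|\Lambda'}=\mu_{free|\Lambda}\ast\mu_{free|\Lambda'\setminus\Lambda},$$ where $\ast$ is the convolution of measures induced by the addition of fields. -/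

import Mathlib

open MeasureTheory
open scoped SchwartzMap

noncomputable section

namespace EuclideanQFT

section Fields

variable (E : Type*) [NormedAddCommGroup E] [InnerProductSpace ℝ E]

/-- The space of (generalized, real) fields on the Euclidean space-time `E`: real tempered
distributions. A field `φ` is paired with a source `f : 𝓢(E, ℝ)` as `φ f`; an ordinary function `u`
is the field `f ↦ ∫ u f dν`, where `ν` is the normalized Lebesgue measure `nu` below. -/
abbrev FieldSpace : Type _ := 𝓢(E, ℝ) →L[ℝ] ℝ

/-- The cylinder σ-algebra on fields: the smallest one that makes every evaluation `φ ↦ φ f`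
measurable. -/
instance instMeasurableSpaceFieldSpace : MeasurableSpace (FieldSpace E) :=
  ⨆ f : 𝓢(E, ℝ), MeasurableSpace.comap (fun φ : FieldSpace E => φ f) inferInstance

variable {E}

theorem measurable_eval (f : 𝓢(E, ℝ)) : Measurable (fun φ : FieldSpace E => φ f) :=
  Measurable.of_comap_le (le_iSup
    (fun f : 𝓢(E, ℝ) => MeasurableSpace.comap (fun φ : FieldSpace E => φ f) inferInstance) f)

theorem measurable_of_eval {α : Type*} [MeasurableSpace α] {g : α → FieldSpace E}
    (hg : ∀ f : 𝓢(E, ℝ), Measurable fun a => g a f) : Measurable g := by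
  refine Measurable.of_le_map (iSup_le fun f => ?_)
  rintro _ ⟨t, ht, rfl⟩
  exact hg f ht

/-- Addition of fields is measurable, so that `MeasureTheory.Measure.conv` is the genuine
convolution of measures on the space of fields. -/
instance instMeasurableAddFieldSpace : MeasurableAdd₂ (FieldSpace E) where
  measurable_add := measurable_of_eval fun f =>
    ((measurable_eval f).comp measurable_fst).add ((measurable_eval f).comp measurable_snd)

end Fields

variable {E : Type*} [NormedAddCommGroup E] [InnerProductSpace ℝ E] [FiniteDimensional ℝ E]
  [MeasurableSpace E] [BorelSpace E]

variable (E) in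
/-- The measure `dν = (2π)^(-d/2) dx`, `d = dim E`, used both on space-time and on momentum space
(identified by the inner product). It makes `ũ(p) = ∫ u(x) e^{-i(p,x)} dν(x)` unitary, with
inverse `u(x) = ∫ ũ(p) e^{i(p,x)} dν(p)`. -/
def nu : Measure E :=
  ENNReal.ofReal ((2 * Real.pi) ^ (-(Module.finrank ℝ E : ℝ) / 2)) • volume

variable (E) in
/-- The momentum shell `I_{Λ'∖Λ} = {p | Λ² ≤ p² ≤ Λ'²}`. The ball `I_{Λ'}` is the case `Λ = 0`. -/
def momentumShell (Λ Λ' : ℝ) : Set E := {p | Λ ^ 2 ≤ ‖p‖ ^ 2 ∧ ‖p‖ ^ 2 ≤ Λ' ^ 2}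

/-- The Fourier transform of the sharply regularized propagator of the free action with symbol `k`,
`S_free(φ) = ∫ k(p) φ̃(p) φ̃(-p) dν(p)`: it agrees with the Fourier transform `1 / k` of the
propagator on the shell `I_{Λ'∖Λ}` and vanishes outside. -/
def sharpPropagatorFourier (k : E → ℝ) (Λ Λ' : ℝ) : E → ℝ :=
  (momentumShell E Λ Λ').indicator fun p => (k p)⁻¹

/-- The sharply regularized propagator, as a kernel:
`K(x, y) = ∫ K̃(p) e^{i(p, x - y)} dν(p)`, with `K̃` the symbol `sharpPropagatorFourier`. -/
def sharpPropagator (k : E → ℝ) (Λ Λ' : ℝ) (x y : E) : ℂ :=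
  ∫ p, (sharpPropagatorFourier k Λ Λ' p : ℂ) *
    Complex.exp (Complex.I * (inner ℝ p (x - y) : ℝ)) ∂(nu E)

/-- The quadratic form `f ↦ ∫∫ K(x, y) f(x) f(y) dν(x) dν(y)` on sources whose kernel is the sharply
regularized propagator. This is the inverse form of the regularized free action. -/
def sharpInverseForm (k : E → ℝ) (Λ Λ' : ℝ) (f : 𝓢(E, ℝ)) : ℂ :=
  ∫ x, ∫ y, sharpPropagator k Λ Λ' x y * (f x : ℂ) * (f y : ℂ) ∂(nu E) ∂(nu E)

/-- `μ` is the normalized Gaussian measure `e^{-S(φ)} Dφ` for the sharply regularized free action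
`S` (with modes in `I_{Λ'∖Λ}`): the probability measure on fields that has the characteristic
functional `∫ e^{iφ(f)} dμ(φ) = exp(-S⁻¹(f) / 4)`, with `S⁻¹` the inverse form of `S`.
The weight is `e^{-S}`, not `e^{-S/2}`, whence the covariance `S⁻¹ / 2` and the factor `1 / 4`, as
in the finite-dimensional formula
`∫ e^{-(x, Ax) + i(f, x)} dx / ∫ e^{-(x, Ax)} dx = exp(-(f, A⁻¹ f) / 4)`. -/
def IsSharpFreeMeasure (k : E → ℝ) (Λ Λ' : ℝ) (μ : Measure (FieldSpace E)) : Prop :=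
  IsProbabilityMeasure μ ∧
    ∀ f : 𝓢(E, ℝ), ∫ φ, Complex.exp (Complex.I * (φ f : ℝ)) ∂μ =
      Complex.exp (-(1 / 4) * sharpInverseForm k Λ Λ' f)

open Classical in
/-- The sharply regularized free Gaussian measure `μ_{free|Λ'∖Λ}`: the measure characterized by
`IsSharpFreeMeasure` (and `0` if there were none). `μ_{free|Λ'}` is the case `Λ = 0`. -/
def sharpFreeMeasure (k : E → ℝ) (Λ Λ' : ℝ) : Measure (FieldSpace E) :=
  if h : ∃ μ, IsSharpFreeMeasure k Λ Λ' μ then h.choose else 0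

end EuclideanQFT

end

/-!
A finite measure on fields is determined by its characteristic functional (`ext_of_charFunctional`):
the functional contains the characteristic functions of all finite-dimensional marginals, and these
determine a measure on the cylinder σ-algebra. This gives uniqueness. Characteristic functionals
turn convolutions into products (`charFunctional_conv`), so the convolution identity follows once the
inverse forms of the shells `I_Λ` and `I_{Λ'∖Λ}` add up to that of `I_{Λ'}`
(`sharpInverseForm_add`); this holds because the two shells overlap only in a sphere, a null set.

Existence needs no general theorem on positive-definite functionals on nuclear spaces, because the
symbol `S` of the regularized propagator is integrable. As `S` is also nonnegative and even, the
propagator is an inner product, `K(x, y) = ⟪c x, c y⟫`, of values of a bounded continuous map `c`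
into the real Hilbert space `L²(ν)`, namely `c x = √S (cos (·, x) + sin (·, x))`
(`exists_feature_map`). Hence the inverse form of the action is `f ↦ ‖∫ f c dν‖²`. For an
orthonormal basis `b` and independent standard normal variables `ξ i`, the random field
`φ(x) = 2^(-1/2) ∑ ξ i ⟪b i, c x⟫` has the required covariance. The functions `⟪b i, c ·⟫`, divided
by a weight of polynomial growth, have square-summable norms in `L²(ν)`, because
`∑ ⟪b i, c x⟫² = ‖c x‖²` is bounded. So the weighted series converges in mean square to an
`L²(ν)`-valued random vector (`exists_gaussian_random_vector`), and pairing that vector with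
`weight • f` defines `φ(f)`, which is linear and continuous in the Schwartz function `f`
(`exists_gaussian_field`).
-/

open MeasureTheory
open scoped SchwartzMap

noncomputable section

namespace EuclideanQFT

open ProbabilityTheory Complex

/-! ### Characteristic functionals of measures on fields -/

section Uniqueness

variable {E : Type*} [NormedAddCommGroup E] [InnerProductSpace ℝ E]

/-- The cylinder σ-algebra on fields is induced by the product σ-algebra on `𝓢(E, ℝ) → ℝ`. -/
theorem measurableSpace_fieldSpace_eq_comap :
    instMeasurableSpaceFieldSpace E =
      MeasurableSpace.comap (fun (φ : FieldSpace E) (f : 𝓢(E, ℝ)) => φ f) MeasurableSpace.pi := by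
  simp only [instMeasurableSpaceFieldSpace, MeasurableSpace.pi, MeasurableSpace.comap_iSup,
    MeasurableSpace.comap_comp]
  rfl

/-- A finite measure on fields is determined by its characteristic functional: a linear combination
of evaluations is again an evaluation, so the functional contains the characteristic functions of
all finite-dimensional marginals. -/
theorem ext_of_charFunctional {μ ν : Measure (FieldSpace E)} [IsFiniteMeasure μ]
    [IsFiniteMeasure ν]
    (h : ∀ f : 𝓢(E, ℝ), ∫ φ, exp (I * (φ f : ℝ)) ∂μ = ∫ φ, exp (I * (φ f : ℝ)) ∂ν) : μ = ν := by
  set J : FieldSpace E → 𝓢(E, ℝ) → ℝ := fun φ f => φ f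
  have hJ : Measurable J := measurable_pi_lambda _ measurable_eval
  have hr (s : Finset 𝓢(E, ℝ)) : Measurable fun φ : FieldSpace E => s.restrict (J φ) :=
    (Finset.measurable_restrict s).comp hJ
  have key (s : Finset 𝓢(E, ℝ)) :
      (μ.map J).map s.restrict = (ν.map J).map s.restrict := by
    classical
    rw [Measure.map_map (Finset.measurable_restrict s) hJ,
      Measure.map_map (Finset.measurable_restrict s) hJ]
    refine Measure.ext_of_charFunDual ?_
    ext L
    have hL (φ : FieldSpace E) : L (s.restrict (J φ)) =
        φ (∑ i : s, L (Pi.single i 1) • (i : 𝓢(E, ℝ))) := by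
      conv_lhs => rw [← Finset.univ_sum_single (s.restrict (J φ))]
      rw [map_sum, map_sum]
      refine Finset.sum_congr rfl fun i _ => ?_
      have : (Pi.single i (s.restrict (J φ) i) : s → ℝ) = (φ i) • Pi.single i 1 := by
        rw [← Pi.single_smul]; simp [J]
      rw [this, map_smul, map_smul, smul_eq_mul, smul_eq_mul, mul_comm]
    have hm : AEStronglyMeasurable (fun v : s → ℝ => exp (L v * I))
        (μ.map (s.restrict ∘ J)) := by fun_prop
    have hm' : AEStronglyMeasurable (fun v : s → ℝ => exp (L v * I))
        (ν.map (s.restrict ∘ J)) := by fun_prop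
    rw [charFunDual_apply, charFunDual_apply,
      integral_map (φ := s.restrict ∘ J) (hr s).aemeasurable hm,
      integral_map (φ := s.restrict ∘ J) (hr s).aemeasurable hm']
    simp only [Function.comp_apply, hL, mul_comm _ I]
    exact h _
  have hmap : μ.map J = ν.map J :=
    IsProjectiveLimit.unique (P := fun s => (ν.map J).map s.restrict) key fun s => rfl
  refine Measure.ext fun t ht => ?_
  rw [measurableSpace_fieldSpace_eq_comap] at ht
  obtain ⟨u, hu, rfl⟩ := ht
  have := congrArg (fun m => m u) hmap
  simpa only [Measure.map_apply hJ hu] using this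

theorem charFunctional_conv (μ ν : Measure (FieldSpace E)) [IsFiniteMeasure μ]
    [IsFiniteMeasure ν] (f : 𝓢(E, ℝ)) :
    ∫ φ, exp (I * (φ f : ℝ)) ∂(μ.conv ν) =
      (∫ φ, exp (I * (φ f : ℝ)) ∂μ) * ∫ φ, exp (I * (φ f : ℝ)) ∂ν := by
  have hm : Measurable fun φ : FieldSpace E => exp (I * (φ f : ℝ)) := by
    exact (Complex.measurable_ofReal.comp (measurable_eval f)).const_mul I |>.cexp
  rw [Measure.conv, integral_map (by fun_prop) hm.aestronglyMeasurable, ← integral_prod_mul]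
  simp only [add_apply, ofReal_add, mul_add, exp_add]

end Uniqueness

/-! ### Gaussian series in a Hilbert space -/

section GaussianSeries

variable {H : Type*} [NormedAddCommGroup H] [InnerProductSpace ℝ H] {ι : Type*}

variable (ι) in
/-- The law of a family of independent standard normal variables `ξ i`, `i : ι`, realized as the
coordinates on `ι → ℝ`. -/
abbrev whiteNoise : Measure (ι → ℝ) := Measure.infinitePi fun _ => gaussianReal 0 1

theorem memLp_coord (i : ι) : MemLp (fun ω : ι → ℝ => ω i) 2 (whiteNoise ι) :=
  (memLp_id_gaussianReal' 2 (by simp)).comp_measurePreserving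
    (measurePreserving_eval_infinitePi (fun _ : ι => gaussianReal 0 1) i)

theorem integral_comp_coord {F : Type*} [NormedAddCommGroup F] [NormedSpace ℝ F] (i : ι)
    {g : ℝ → F} (hg : StronglyMeasurable g) :
    ∫ ω, g (ω i) ∂(whiteNoise ι) = ∫ t, g t ∂(gaussianReal 0 1) := by
  rw [← (measurePreserving_eval_infinitePi (fun _ : ι => gaussianReal 0 1) i).map_eq,
    integral_map (measurable_pi_apply i).aemeasurable hg.aestronglyMeasurable]

theorem integral_coord_mul_coord_self (i : ι) :
    ∫ ω, ω i * ω i ∂(whiteNoise ι) = 1 := by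
  rw [integral_comp_coord i (g := fun t => t * t) (by fun_prop)]
  have := variance_id_gaussianReal (μ := 0) (v := 1)
  rw [variance_of_integral_eq_zero (by fun_prop) (by simp)] at this
  simpa [pow_two] using this

theorem iIndepFun_coord : iIndepFun (fun (i : ι) (ω : ι → ℝ) => ω i) (whiteNoise ι) :=
  iIndepFun_infinitePi (P := fun _ : ι => gaussianReal 0 1) (X := fun _ t => t)
    (fun _ => measurable_id)

theorem integral_coord_mul_coord_of_ne {i j : ι} (hij : i ≠ j) :
    ∫ ω, ω i * ω j ∂(whiteNoise ι) = 0 := by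
  rw [(iIndepFun_coord.indepFun hij).integral_fun_mul_eq_mul_integral
      (measurable_pi_apply i).aestronglyMeasurable (measurable_pi_apply j).aestronglyMeasurable,
    integral_comp_coord i (g := fun t => t) (by fun_prop)]
  simp

theorem integral_exp_sum_coord (s : Finset ι) (t : ι → ℝ) :
    ∫ ω, exp (I * (∑ i ∈ s, ω i * t i : ℝ)) ∂(whiteNoise ι) =
      exp (-(1 / 2) * (∑ i ∈ s, t i ^ 2 : ℝ)) := by
  have h1 : ∀ ω : ι → ℝ, exp (I * (∑ i ∈ s, ω i * t i : ℝ)) =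
      ∏ i : s, exp (t i * ω i * I) := by
    intro ω
    rw [← exp_sum, ← Finset.sum_coe_sort s, ← Finset.sum_mul, mul_comm I]
    push_cast
    simp only [mul_comm]
  simp_rw [h1]
  have hind : iIndepFun (fun (i : s) (ω : ι → ℝ) => ω i) (whiteNoise ι) :=
    iIndepFun_coord.precomp Subtype.val_injective
  rw [hind.integral_fun_prod_comp (f := fun (i : s) (x : ℝ) => exp (t i * x * I))
    (fun i => (measurable_pi_apply (i : ι)).aemeasurable) (by fun_prop)]
  have h2 (i : s) : ∫ ω, exp (t i * (ω i : ℝ) * I) ∂(whiteNoise ι) =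
      exp (-(1 / 2) * (t i ^ 2 : ℝ)) := by
    rw [integral_comp_coord (i : ι) (g := fun x : ℝ => exp (t i * x * I)) (by fun_prop),
      ← charFun_apply_real, charFun_gaussianReal]
    congr 1
    push_cast
    ring
  simp_rw [h2]
  rw [← exp_sum, ← Finset.mul_sum, Finset.sum_coe_sort s fun i => ((t i ^ 2 : ℝ) : ℂ)]
  push_cast
  rfl

theorem memLp_coord_smul (i : ι) (h : H) :
    MemLp (fun ω : ι → ℝ => ω i • h) 2 (whiteNoise ι) :=
  (ContinuousLinearMap.toSpanSingleton ℝ h).comp_memLp' (memLp_coord i)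

theorem inner_toLp_coord_smul (i j : ι) (h h' : H) :
    inner ℝ ((memLp_coord_smul i h).toLp) ((memLp_coord_smul j h').toLp) =
      (∫ ω, ω i * ω j ∂(whiteNoise ι)) * inner ℝ h h' := by
  rw [L2.inner_def, ← integral_mul_const]
  refine integral_congr_ae ?_
  filter_upwards [(memLp_coord_smul i h).coeFn_toLp, (memLp_coord_smul j h').coeFn_toLp]
    with ω h1 h2
  rw [h1, h2, real_inner_smul_left, real_inner_smul_right, mul_assoc]

/-- The isometry `h ↦ ξ i • h` of `H` into the square-integrable `H`-valued random vectors. -/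
def coordSMul (H : Type*) [NormedAddCommGroup H] [InnerProductSpace ℝ H] (i : ι) :
    H →ₗᵢ[ℝ] Lp H 2 (whiteNoise ι) where
  toFun h := (memLp_coord_smul i h).toLp
  map_add' x y := by
    rw [← MemLp.toLp_add]
    exact MemLp.toLp_congr _ _ (.of_forall fun ω => smul_add _ _ _)
  map_smul' c x := by
    rw [RingHom.id_apply, ← MemLp.toLp_const_smul]
    exact MemLp.toLp_congr _ _ (.of_forall fun ω => smul_comm _ _ _)
  norm_map' h := by
    have := inner_toLp_coord_smul i i h h
    rw [integral_coord_mul_coord_self, one_mul, real_inner_self_eq_norm_sq,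
      real_inner_self_eq_norm_sq] at this
    exact (pow_left_inj₀ (norm_nonneg _) (norm_nonneg _) two_ne_zero).1 this

theorem coeFn_coordSMul (i : ι) (h : H) :
    coordSMul H i h =ᵐ[whiteNoise ι] fun ω => ω i • h :=
  (memLp_coord_smul i h).coeFn_toLp

theorem orthogonalFamily_coordSMul :
    OrthogonalFamily ℝ (fun _ : ι => H) (coordSMul H) := fun i j hij h h' => by
  refine (inner_toLp_coord_smul i j h h').trans ?_
  rw [integral_coord_mul_coord_of_ne hij, zero_mul]

theorem norm_exp_I_mul_sub_exp_I_mul_le (x y : ℝ) :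
    ‖exp (I * x) - exp (I * y)‖ ≤ |x - y| := by
  have h : exp (I * x) - exp (I * y) = exp (I * y) * (exp (I * ((x - y : ℝ) : ℂ)) - 1) := by
    rw [mul_sub, ← exp_add]
    push_cast
    ring_nf
  rw [h, norm_mul, norm_exp_I_mul_ofReal, one_mul]
  exact Real.norm_exp_I_mul_ofReal_sub_one_le

/-- The characteristic functional of a square-integrable random vector depends continuously on the
vector. -/
theorem continuous_integral_exp_inner {Ω : Type*} [MeasurableSpace Ω] (P : Measure Ω)
    [IsProbabilityMeasure P] (h : H) :
    Continuous fun X : Lp H 2 P => ∫ ω, exp (I * (inner ℝ (X ω) h : ℝ)) ∂P := by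
  have hm (X : Lp H 2 P) : Integrable (fun ω => exp (I * (inner ℝ (X ω) h : ℝ))) P := by
    refine Integrable.of_bound (C := 1) ?_ (.of_forall fun ω => (norm_exp_I_mul_ofReal _).le)
    have := (Lp.aestronglyMeasurable X).inner (aestronglyMeasurable_const (b := h)) (𝕜 := ℝ)
    exact (by fun_prop : Continuous fun t : ℝ => exp (I * t)).comp_aestronglyMeasurable this
  refine (LipschitzWith.of_dist_le_mul (K := ‖h‖₊) fun X Y => ?_).continuous
  rw [dist_eq_norm, dist_eq_norm, ← integral_sub (hm X) (hm Y), mul_comm]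
  have hXY : Integrable (fun ω => ‖(X - Y : Lp H 2 P) ω‖) P :=
    ((Lp.memLp (X - Y)).integrable one_le_two).norm
  have h1 : ∫ ω, ‖(X - Y : Lp H 2 P) ω‖ ∂P ≤ ‖X - Y‖ := by
    rw [integral_norm_eq_lintegral_enorm (Lp.aestronglyMeasurable _),
      ← eLpNorm_one_eq_lintegral_enorm, Lp.norm_def]
    exact ENNReal.toReal_mono (Lp.eLpNorm_ne_top _)
      (eLpNorm_le_eLpNorm_of_exponent_le one_le_two (Lp.aestronglyMeasurable _))
  refine le_trans ?_ (mul_le_mul_of_nonneg_right h1 (norm_nonneg h))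
  rw [← integral_mul_const]
  refine norm_integral_le_of_norm_le (hXY.mul_const _) ?_
  filter_upwards [Lp.coeFn_sub X Y] with ω hω
  refine (norm_exp_I_mul_sub_exp_I_mul_le _ _).trans ?_
  rw [← inner_sub_left, hω, Pi.sub_apply]
  exact abs_real_inner_le_norm _ _

/-- If `∑ ‖a i‖² < ∞`, the series `∑ ξ i • a i` with independent standard normal `ξ i` converges in
mean square to a centred Gaussian random vector, whose covariance form is `h ↦ ∑ ⟪a i, h⟫²`. -/
theorem exists_gaussian_random_vector [CompleteSpace H] {a : ι → H}
    (ha : Summable fun i => ‖a i‖ ^ 2) :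
    ∃ X : (ι → ℝ) → H, StronglyMeasurable X ∧ ∀ (h : H) (q : ℝ),
      HasSum (fun i => inner ℝ (a i) h ^ 2) q →
      ∫ ω, exp (I * (inner ℝ (X ω) h : ℝ)) ∂(whiteNoise ι) = exp (-(1 / 2) * (q : ℂ)) := by
  obtain ⟨X, hX⟩ := (orthogonalFamily_coordSMul.summable_iff_norm_sq_summable a).2 ha
  refine ⟨X, Lp.stronglyMeasurable X, fun h q hq => ?_⟩
  refine tendsto_nhds_unique
    (((continuous_integral_exp_inner (whiteNoise ι) h).tendsto X).comp hX) ?_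
  have hq' : Filter.Tendsto (fun s : Finset ι => exp (-(1 / 2) *
      ((∑ i ∈ s, inner ℝ (a i) h ^ 2 : ℝ) : ℂ))) Filter.atTop (nhds (exp (-(1 / 2) * (q : ℂ)))) :=
    ((by fun_prop : Continuous fun t : ℝ => exp (-(1 / 2) * (t : ℂ))).tendsto q).comp hq
  refine hq'.congr fun s => ?_
  rw [← integral_exp_sum_coord]
  refine integral_congr_ae ?_
  have hs : ∀ᵐ ω ∂(whiteNoise ι), ∀ i ∈ s, coordSMul H i (a i) ω = ω i • a i :=
    (Filter.eventually_all_finset s).2 fun i _ => coeFn_coordSMul i (a i)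
  filter_upwards [hs, Lp.coeFn_finsetSum s fun i => coordSMul H i (a i)] with ω h1 h2
  rw [h2, Finset.sum_apply, Finset.sum_congr rfl h1, sum_inner]
  simp only [real_inner_smul_left]

end GaussianSeries
/-! ### Gaussian fields from maps into a Hilbert space -/

section FeatureMap

variable {E : Type*} [NormedAddCommGroup E] [InnerProductSpace ℝ E] [FiniteDimensional ℝ E]
  [MeasurableSpace E] [BorelSpace E]

instance isAddHaarMeasure_nu : (nu E).IsAddHaarMeasure :=
  Measure.IsAddHaarMeasure.smul volume
    (by rw [ne_eq, ENNReal.ofReal_eq_zero, not_le]; positivity) ENNReal.ofReal_ne_top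

variable (E) in
/-- A power of `1 + ‖x‖²` so high that its inverse is square-integrable. -/
def weight (x : E) : ℝ := (1 + ‖x‖ ^ 2) ^ (((Module.finrank ℝ E : ℝ) + 1) / 4)

theorem weight_pos {V : Type*} [NormedAddCommGroup V] [InnerProductSpace ℝ V] (x : V) :
    0 < weight V x := by
  unfold weight
  positivity

theorem hasTemperateGrowth_weight {V : Type*} [NormedAddCommGroup V] [InnerProductSpace ℝ V] :
    (weight V).HasTemperateGrowth :=
  Function.hasTemperateGrowth_one_add_norm_sq_rpow V _

theorem continuous_weight {V : Type*} [NormedAddCommGroup V] [InnerProductSpace ℝ V] :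
    Continuous (weight V) :=
  hasTemperateGrowth_weight.1.continuous

theorem integrable_inv_weight_sq : Integrable (fun x => (weight E x)⁻¹ ^ 2) (nu E) := by
  refine (integrable_rpow_neg_one_add_norm_sq (E := E) (μ := nu E)
    (r := (Module.finrank ℝ E : ℝ) + 1) (by linarith)).congr (.of_forall fun x => ?_)
  have h : (0 : ℝ) ≤ 1 + ‖x‖ ^ 2 := by positivity
  simp only [weight]
  rw [← Real.rpow_neg h, ← Real.rpow_mul_natCast h]
  congr 1
  push_cast
  ring

variable (E) in
/-- The continuous linear map `f ↦ weight • f` from Schwartz functions to `L²(ν)`. -/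
def weightedToLp : 𝓢(E, ℝ) →L[ℝ] Lp ℝ 2 (nu E) :=
  (SchwartzMap.toLpCLM ℝ ℝ 2 (nu E)).comp (SchwartzMap.smulLeftCLM ℝ (weight E))

theorem coeFn_weightedToLp (f : 𝓢(E, ℝ)) :
    weightedToLp E f =ᵐ[nu E] fun x => weight E x * f x := by
  filter_upwards [SchwartzMap.coeFn_toLp (SchwartzMap.smulLeftCLM ℝ (weight E) f) 2 (nu E)]
    with x hx
  exact hx.trans (SchwartzMap.smulLeftCLM_apply_apply hasTemperateGrowth_weight f x)

/-- A bounded continuous function becomes square-integrable after division by `weight`. -/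
theorem memLp_mul_inv_weight {g : E → ℝ} (hg : Continuous g) {C : ℝ} (hC : ∀ x, |g x| ≤ C) :
    MemLp (fun x => g x * (weight E x)⁻¹) 2 (nu E) := by
  have hc : Continuous fun x => g x * (weight E x)⁻¹ :=
    hg.mul (continuous_weight.inv₀ fun x => (weight_pos x).ne')
  refine (memLp_two_iff_integrable_sq hc.aestronglyMeasurable).2 ?_
  refine (integrable_inv_weight_sq.const_mul (C ^ 2)).mono' (hc.pow 2).aestronglyMeasurable
    (.of_forall fun x => ?_)
  rw [Real.norm_of_nonneg (sq_nonneg _), mul_pow]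
  exact mul_le_mul_of_nonneg_right (sq_le_sq' (abs_le.1 (hC x)).1 (abs_le.1 (hC x)).2)
    (sq_nonneg _)

/-- The weights cancel: the bounded function `g` acts on Schwartz functions as the distribution
`f ↦ ∫ f g dν`. -/
theorem inner_toLp_weightedToLp {g : E → ℝ} (hg : Continuous g) {C : ℝ} (hC : ∀ x, |g x| ≤ C)
    (f : 𝓢(E, ℝ)) :
    inner ℝ ((memLp_mul_inv_weight hg hC).toLp) (weightedToLp E f) =
      ∫ x, f x * g x ∂(nu E) := by
  rw [L2.inner_def]
  refine integral_congr_ae ?_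
  filter_upwards [(memLp_mul_inv_weight hg hC).coeFn_toLp, coeFn_weightedToLp f] with x h1 h2
  have := (weight_pos x).ne'
  rw [h1, h2, real_inner_eq_re_inner, RCLike.inner_apply]
  simp
  field_simp

theorem integrable_smul_of_bounded {H : Type*} [NormedAddCommGroup H] [NormedSpace ℝ H]
    {c : E → H} (hc : Continuous c) {C : ℝ} (hC : ∀ x, ‖c x‖ ≤ C) (f : 𝓢(E, ℝ)) :
    Integrable (fun x => f x • c x) (nu E) :=
  f.integrable.smul_bdd C hc.aestronglyMeasurable (.of_forall hC)

/-- A bounded continuous map `c` into a Hilbert space gives a Gaussian measure on fields with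
covariance kernel `⟪c x, c y⟫ / 2`. With an orthonormal basis `b` of the Hilbert space, the field is
`φ(x) = 2^(-1/2) ∑ ξ i ⟪b i, c x⟫`. After division by `weight`, the series converges in `L²(ν)`,
since `∑ ⟪b i, c x⟫² = ‖c x‖²` is bounded. -/
theorem exists_gaussian_field {H : Type*} [NormedAddCommGroup H] [InnerProductSpace ℝ H]
    [CompleteSpace H] {c : E → H} (hc : Continuous c) {C : ℝ} (hC : ∀ x, ‖c x‖ ≤ C) :
    ∃ μ : Measure (FieldSpace E), IsProbabilityMeasure μ ∧ ∀ f : 𝓢(E, ℝ),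
      ∫ φ, exp (I * (φ f : ℝ)) ∂μ =
        exp (-(1 / 4) * ((‖∫ x, f x • c x ∂(nu E)‖ ^ 2 : ℝ) : ℂ)) := by
  obtain ⟨ι, b, -⟩ := exists_hilbertBasis ℝ H
  -- The characteristic function of a standard normal variable contributes a factor `1 / 2` to the
  -- exponent; `s ^ 2 = 1 / 2` contributes the other one.
  set s : ℝ := (√2)⁻¹ with hs
  have hs2 : s ^ 2 = 1 / 2 := by rw [hs, inv_pow, Real.sq_sqrt zero_le_two, one_div]
  let g : ι → E → ℝ := fun i x => s * inner ℝ (b i) (c x)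
  have hg (i : ι) : Continuous (g i) := continuous_const.mul (continuous_const.inner hc)
  have hgC (i : ι) (x : E) : |g i x| ≤ s * C := by
    rw [abs_mul, abs_of_nonneg (by positivity : 0 ≤ s)]
    refine mul_le_mul_of_nonneg_left ((abs_real_inner_le_norm _ _).trans ?_) (by positivity)
    rw [b.orthonormal.1 i, one_mul]
    exact hC x
  let a : ι → Lp ℝ 2 (nu E) := fun i => (memLp_mul_inv_weight (hg i) (hgC i)).toLp
  have hparseval (v : H) : HasSum (fun i => inner ℝ (b i) v ^ 2) (‖v‖ ^ 2) := by
    have := b.hasSum_inner_mul_inner v v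
    rw [real_inner_self_eq_norm_sq] at this
    refine this.congr_fun fun i => ?_
    rw [real_inner_comm, pow_two]
  have hint (i : ι) : Integrable (fun x => (g i x * (weight E x)⁻¹) ^ 2) (nu E) :=
    (memLp_mul_inv_weight (hg i) (hgC i)).integrable_sq
  have hnorm (i : ι) : ‖a i‖ ^ 2 = ∫ x, (g i x * (weight E x)⁻¹) ^ 2 ∂(nu E) := by
    rw [← real_inner_self_eq_norm_sq, L2.inner_def]
    refine integral_congr_ae ?_
    filter_upwards [(memLp_mul_inv_weight (hg i) (hgC i)).coeFn_toLp] with x hx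
    rw [hx, real_inner_self_eq_norm_sq, Real.norm_eq_abs, sq_abs]
  -- Bessel's inequality under the integral sign bounds all finite sums; since no interchange with
  -- an infinite sum is involved, `ι` need not be countable.
  have ha : Summable fun i => ‖a i‖ ^ 2 := by
    refine summable_of_sum_le (c := ∫ x, s ^ 2 * C ^ 2 * (weight E x)⁻¹ ^ 2 ∂(nu E))
      (fun i => sq_nonneg _) fun t => ?_
    simp_rw [hnorm]
    rw [← integral_finsetSum _ fun i _ => hint i]
    refine integral_mono (integrable_finsetSum _ fun i _ => hint i)
      (integrable_inv_weight_sq.const_mul _) fun x => ?_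
    simp only [g, mul_pow]
    rw [← Finset.sum_mul, ← Finset.mul_sum]
    refine mul_le_mul_of_nonneg_right (mul_le_mul_of_nonneg_left ?_ (sq_nonneg _)) (sq_nonneg _)
    exact (sum_le_hasSum t (fun i _ => sq_nonneg _) (hparseval (c x))).trans
      (pow_le_pow_left₀ (norm_nonneg _) (hC x) 2)
  obtain ⟨X, hXm, hX⟩ := exists_gaussian_random_vector ha
  let Y : (ι → ℝ) → FieldSpace E := fun ω => (innerSL ℝ (X ω)).comp (weightedToLp E)
  have hY : Measurable Y := measurable_of_eval fun f =>
    (hXm.inner (𝕜 := ℝ) (stronglyMeasurable_const (b := weightedToLp E f))).measurable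
  refine ⟨(whiteNoise ι).map Y, Measure.isProbabilityMeasure_map hY.aemeasurable, fun f => ?_⟩
  have hm : Measurable fun φ : FieldSpace E => exp (I * (φ f : ℝ)) :=
    ((Complex.measurable_ofReal.comp (measurable_eval f)).const_mul I).cexp
  rw [integral_map hY.aemeasurable hm.aestronglyMeasurable]
  have hq : HasSum (fun i => inner ℝ (a i) (weightedToLp E f) ^ 2)
      (1 / 2 * ‖∫ x, f x • c x ∂(nu E)‖ ^ 2) := by
    rw [← hs2]
    refine ((hparseval _).mul_left _).congr_fun fun i => ?_
    rw [inner_toLp_weightedToLp (hg i) (hgC i),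
      ← integral_inner (integrable_smul_of_bounded hc hC f), ← mul_pow, ← integral_const_mul]
    congr 1
    refine integral_congr_ae (.of_forall fun x => ?_)
    simp only [g, real_inner_smul_right]
    ring
  refine (hX _ _ hq).trans ?_
  congr 1
  push_cast
  ring

end FeatureMap

/-! ### Translation-invariant kernels as inner products -/

section Kernel

variable {E : Type*} [NormedAddCommGroup E] [InnerProductSpace ℝ E] [FiniteDimensional ℝ E]
  [MeasurableSpace E] [BorelSpace E]

/-- `cas t = cos t + sin t`, the kernel of the Hartley transform. -/
def cas (t : ℝ) : ℝ := Real.cos t + Real.sin t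

theorem cas_mul_cas (s t : ℝ) : cas s * cas t = Real.cos (s - t) + Real.sin (s + t) := by
  simp only [cas, Real.cos_sub, Real.sin_add]
  ring

theorem continuous_cas : Continuous cas := Real.continuous_cos.add Real.continuous_sin

section Even

variable {S : E → ℝ}

theorem integrable_mul_cos (hS : Integrable S (nu E)) (z : E) :
    Integrable (fun p => S p * Real.cos (inner ℝ p z)) (nu E) :=
  hS.mul_bdd (c := 1) (by fun_prop) (.of_forall fun _ => Real.abs_cos_le_one _)

theorem integrable_mul_sin (hS : Integrable S (nu E)) (z : E) :
    Integrable (fun p => S p * Real.sin (inner ℝ p z)) (nu E) :=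
  hS.mul_bdd (c := 1) (by fun_prop) (.of_forall fun _ => Real.abs_sin_le_one _)

theorem integral_mul_sin_of_even (heven : ∀ p, S (-p) = S p) (z : E) :
    ∫ p, S p * Real.sin (inner ℝ p z) ∂(nu E) = 0 := by
  have h := integral_neg_eq_self (fun p => S p * Real.sin (inner ℝ p z)) (nu E)
  simp_rw [heven, inner_neg_left, Real.sin_neg, mul_neg, integral_neg] at h
  exact self_eq_neg.1 h.symm

theorem integral_mul_exp_of_even (hS : Integrable S (nu E)) (heven : ∀ p, S (-p) = S p) (z : E) :
    ∫ p, (S p : ℂ) * exp (I * (inner ℝ p z : ℝ)) ∂(nu E) =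
      ((∫ p, S p * Real.cos (inner ℝ p z) ∂(nu E) : ℝ) : ℂ) := by
  have h (p : E) : (S p : ℂ) * exp (I * (inner ℝ p z : ℝ)) =
      ((S p * Real.cos (inner ℝ p z) : ℝ) : ℂ) + ((S p * Real.sin (inner ℝ p z) : ℝ) : ℂ) * I := by
    rw [mul_comm I, exp_mul_I]
    push_cast
    ring
  have hcos : Integrable (fun p => ((S p * Real.cos (inner ℝ p z) : ℝ) : ℂ)) (nu E) :=
    (integrable_mul_cos hS z).ofReal
  have hsin : Integrable (fun p => ((S p * Real.sin (inner ℝ p z) : ℝ) : ℂ)) (nu E) :=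
    (integrable_mul_sin hS z).ofReal
  simp_rw [h]
  rw [integral_add hcos (hsin.mul_const I), integral_mul_const, integral_complex_ofReal,
    integral_complex_ofReal, integral_mul_sin_of_even heven]
  simp

end Even

/-- Feature map of a translation-invariant kernel: if `S` is integrable, even and nonnegative, then
`∫ S(p) e^{i(p, x - y)} dν(p) = ⟪c x, c y⟫` for the bounded continuous map
`c x = √S cas (·, x)` into the real Hilbert space `L²(ν)`. The product `cas (p, x) cas (p, y)` is
`cos (p, x - y) + sin (p, x + y)`, and the sine integrates to zero against the even function `S`. -/
theorem exists_feature_map {S : E → ℝ} (hS : Integrable S (nu E))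
    (hnonneg : ∀ᵐ p ∂(nu E), 0 ≤ S p) (heven : ∀ p, S (-p) = S p) :
    ∃ c : E → Lp ℝ 2 (nu E), Continuous c ∧ (∃ C, ∀ x, ‖c x‖ ≤ C) ∧
      ∀ x y, ∫ p, (S p : ℂ) * exp (I * (inner ℝ p (x - y) : ℝ)) ∂(nu E) =
        ((inner ℝ (c x) (c y) : ℝ) : ℂ) := by
  let u : E → E → ℝ := fun x p => √(S p) * cas (inner ℝ p x)
  have huu (x y : E) : ∀ᵐ p ∂(nu E), u x p * u y p =
      S p * Real.cos (inner ℝ p (x - y)) + S p * Real.sin (inner ℝ p (x + y)) := by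
    filter_upwards [hnonneg] with p hp
    rw [← mul_add, inner_sub_right, inner_add_right, ← cas_mul_cas, mul_mul_mul_comm,
      Real.mul_self_sqrt hp]
  have hmem (x : E) : MemLp (u x) 2 (nu E) := by
    have hm : AEStronglyMeasurable (u x) (nu E) :=
      (Real.continuous_sqrt.comp_aestronglyMeasurable hS.aestronglyMeasurable).mul
        (continuous_cas.comp (by fun_prop)).aestronglyMeasurable
    refine (memLp_two_iff_integrable_sq hm).2
      (((integrable_mul_cos hS (x - x)).add (integrable_mul_sin hS (x + x))).congr ?_)
    filter_upwards [huu x x] with p hp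
    rw [pow_two, hp, Pi.add_apply]
  let c : E → Lp ℝ 2 (nu E) := fun x => (hmem x).toLp
  let G : E → ℝ := fun z => ∫ p, S p * Real.cos (inner ℝ p z) ∂(nu E)
  have hinner (x y : E) : inner ℝ (c x) (c y) = G (x - y) := by
    have h1 : inner ℝ (c x) (c y) = ∫ p, u x p * u y p ∂(nu E) := by
      rw [L2.inner_def]
      refine integral_congr_ae ?_
      filter_upwards [(hmem x).coeFn_toLp, (hmem y).coeFn_toLp] with p hx hy
      rw [hx, hy, real_inner_comm]
      rfl
    rw [h1, integral_congr_ae (huu x y), integral_add (integrable_mul_cos hS _)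
      (integrable_mul_sin hS _), integral_mul_sin_of_even heven, add_zero]
  have hG : Continuous G := by
    refine continuous_of_dominated (bound := fun p => |S p|) (fun z => (integrable_mul_cos hS z).1)
      (fun z => .of_forall fun p => ?_) hS.abs (.of_forall fun p => by fun_prop)
    rw [norm_mul]
    exact mul_le_of_le_one_right (abs_nonneg _) (Real.abs_cos_le_one _)
  refine ⟨c, ?_, ⟨√(G 0), fun x => ?_⟩, fun x y => ?_⟩
  -- Continuity of `c` follows from continuity of the kernel, by polarization.
  · have hdist (x y : E) : ‖c x - c y‖ ^ 2 = 2 * G 0 - 2 * G (x - y) := by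
      rw [norm_sub_sq_real, ← real_inner_self_eq_norm_sq, ← real_inner_self_eq_norm_sq, hinner,
        hinner, hinner, sub_self, sub_self]
      ring
    refine continuous_iff_continuousAt.2 fun y => tendsto_iff_norm_sub_tendsto_zero.2 ?_
    have h1 (x : E) : ‖c x - c y‖ = √(2 * G 0 - 2 * G (x - y)) := by
      rw [← hdist, Real.sqrt_sq (norm_nonneg _)]
    have h2 : Continuous fun x => √(2 * G 0 - 2 * G (x - y)) := by fun_prop
    simp_rw [h1]
    simpa using h2.tendsto y
  · refine Real.le_sqrt_of_sq_le ?_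
    rw [← real_inner_self_eq_norm_sq, hinner, sub_self]
  · rw [integral_mul_exp_of_even hS heven, hinner]

/-- For the kernel of a feature map `c`, the quadratic form on sources is `f ↦ ‖∫ f c dν‖²`. -/
theorem integral_integral_inner_mul {H : Type*} [NormedAddCommGroup H] [InnerProductSpace ℝ H]
    [CompleteSpace H] {c : E → H} (hc : Continuous c) {C : ℝ} (hC : ∀ x, ‖c x‖ ≤ C)
    (f : 𝓢(E, ℝ)) :
    ∫ x, ∫ y, ((inner ℝ (c x) (c y) : ℝ) : ℂ) * (f x : ℂ) * (f y : ℂ) ∂(nu E) ∂(nu E) =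
      ((‖∫ x, f x • c x ∂(nu E)‖ ^ 2 : ℝ) : ℂ) := by
  have hi := integrable_smul_of_bounded hc hC f
  have h1 (x : E) : ∫ y, ((inner ℝ (c x) (c y) : ℝ) : ℂ) * (f x : ℂ) * (f y : ℂ) ∂(nu E) =
      ((inner ℝ (∫ y, f y • c y ∂(nu E)) (f x • c x) : ℝ) : ℂ) := by
    rw [real_inner_comm, ← integral_inner hi, ← integral_complex_ofReal]
    refine integral_congr_ae (.of_forall fun y => ?_)
    simp only [real_inner_smul_left, real_inner_smul_right]
    push_cast
    ring
  simp_rw [h1]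
  rw [integral_complex_ofReal, integral_inner hi, real_inner_self_eq_norm_sq]

end Kernel

/-! ### Momentum shells and the regularized propagator -/

section Shell

variable {E : Type*} [NormedAddCommGroup E] [InnerProductSpace ℝ E] [FiniteDimensional ℝ E]
  [MeasurableSpace E] [BorelSpace E]

theorem mem_momentumShell {V : Type*} [NormedAddCommGroup V] {a b : ℝ} {p : V} :
    p ∈ momentumShell V a b ↔ a ^ 2 ≤ ‖p‖ ^ 2 ∧ ‖p‖ ^ 2 ≤ b ^ 2 :=
  Iff.rfl

theorem measurableSet_momentumShell {V : Type*} [NormedAddCommGroup V] [MeasurableSpace V]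
    [OpensMeasurableSpace V] (a b : ℝ) : MeasurableSet (momentumShell V a b) :=
  (measurableSet_le measurable_const (measurable_norm.pow_const 2)).inter
    (measurableSet_le (measurable_norm.pow_const 2) measurable_const)

theorem momentumShell_subset_closedBall {V : Type*} [NormedAddCommGroup V] (a : ℝ) {b : ℝ}
    (hb : 0 ≤ b) : momentumShell V a b ⊆ Metric.closedBall 0 b := fun p hp => by
  rw [mem_closedBall_zero_iff]
  exact (pow_le_pow_iff_left₀ (norm_nonneg p) hb two_ne_zero).1 hp.2

theorem nu_absolutelyContinuous : nu E ≪ volume :=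
  Measure.smul_absolutelyContinuous

theorem integrable_sharpPropagatorFourier {k : E → ℝ}
    (hk_int : LocallyIntegrable (fun p => (k p)⁻¹)) (a : ℝ) {b : ℝ} (hb : 0 ≤ b) :
    Integrable (sharpPropagatorFourier k a b) (nu E) := by
  refine Integrable.smul_measure ?_ ENNReal.ofReal_ne_top
  rw [sharpPropagatorFourier, integrable_indicator_iff (measurableSet_momentumShell a b)]
  exact (hk_int.integrableOn_isCompact (isCompact_closedBall 0 b)).mono_set
    (momentumShell_subset_closedBall a hb)

theorem sharpPropagatorFourier_nonneg {k : E → ℝ} (hk_pos : ∀ᵐ p, 0 < k p) (a b : ℝ) :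
    ∀ᵐ p ∂(nu E), 0 ≤ sharpPropagatorFourier k a b p := by
  filter_upwards [nu_absolutelyContinuous.ae_le hk_pos] with p hp
  exact Set.indicator_apply_nonneg fun _ => (inv_pos.2 hp).le

theorem sharpPropagatorFourier_neg {V : Type*} [NormedAddCommGroup V] {k : V → ℝ}
    (hk_even : ∀ p, k (-p) = k p) (a b : ℝ) (p : V) :
    sharpPropagatorFourier k a b (-p) = sharpPropagatorFourier k a b p := by
  classical
  simp only [sharpPropagatorFourier, Set.indicator_apply, mem_momentumShell, norm_neg, hk_even]

/-- Adjacent shells overlap in a sphere, a null set, so the symbols of the regularized propagators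
add up almost everywhere. -/
theorem sharpPropagatorFourier_add [Nontrivial E] (k : E → ℝ) {a b c : ℝ} (ha : 0 ≤ a)
    (hab : a ≤ b) (hbc : b ≤ c) :
    ∀ᵐ p ∂(nu E), sharpPropagatorFourier k a c p =
      sharpPropagatorFourier k a b p + sharpPropagatorFourier k b c p := by
  have hs : ∀ᵐ p ∂(nu E), p ∉ Metric.sphere (0 : E) b :=
    measure_eq_zero_iff_ae_notMem.1 (Measure.addHaar_sphere (nu E) 0 b)
  filter_upwards [hs] with p hp
  rw [mem_sphere_zero_iff_norm] at hp
  have h1 : a ^ 2 ≤ b ^ 2 := pow_le_pow_left₀ ha hab 2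
  have h2 : b ^ 2 ≤ c ^ 2 := pow_le_pow_left₀ (ha.trans hab) hbc 2
  have h3 : ‖p‖ ^ 2 ≠ b ^ 2 := fun h =>
    hp ((pow_left_inj₀ (norm_nonneg p) (ha.trans hab) two_ne_zero).1 h)
  classical
  simp only [sharpPropagatorFourier, Set.indicator_apply, mem_momentumShell]
  rcases lt_or_gt_of_ne h3 with h | h
  · simp only [h.not_ge, h.le, h.le.trans h2, and_true, if_false, add_zero]
  · simp only [h.not_ge, h.le, h1.trans h.le, and_false, true_and, if_false, zero_add]

theorem sharpPropagator_add [Nontrivial E] {k : E → ℝ}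
    (hk_int : LocallyIntegrable (fun p => (k p)⁻¹)) {a b c : ℝ} (ha : 0 ≤ a)
    (hab : a ≤ b) (hbc : b ≤ c) (x y : E) :
    sharpPropagator k a c x y = sharpPropagator k a b x y + sharpPropagator k b c x y := by
  have hi {a b : ℝ} (hb : 0 ≤ b) : Integrable (fun p => (sharpPropagatorFourier k a b p : ℂ) *
      exp (I * (inner ℝ p (x - y) : ℝ))) (nu E) :=
    (integrable_sharpPropagatorFourier hk_int a hb).ofReal.mul_bdd (c := 1) (by fun_prop)
      (.of_forall fun p => (norm_exp_I_mul_ofReal _).le)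
  rw [sharpPropagator, sharpPropagator, sharpPropagator,
    ← integral_add (hi (ha.trans hab)) (hi ((ha.trans hab).trans hbc))]
  refine integral_congr_ae ?_
  filter_upwards [sharpPropagatorFourier_add k ha hab hbc] with p hp
  rw [hp, ofReal_add, add_mul]

end Shell

/-! ### The sharply regularized free measures -/

section FreeMeasure

variable {E : Type*} [NormedAddCommGroup E] [InnerProductSpace ℝ E] [FiniteDimensional ℝ E]
  [MeasurableSpace E] [BorelSpace E] {k : E → ℝ}

/-- The sharply regularized propagator is the kernel of a feature map. -/
theorem exists_feature_map_sharpPropagator (hk_even : ∀ p, k (-p) = k p)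
    (hk_pos : ∀ᵐ p, 0 < k p) (hk_int : LocallyIntegrable (fun p => (k p)⁻¹)) (a : ℝ) {b : ℝ}
    (hb : 0 ≤ b) :
    ∃ c : E → Lp ℝ 2 (nu E), Continuous c ∧ (∃ C, ∀ x, ‖c x‖ ≤ C) ∧
      ∀ x y, sharpPropagator k a b x y = ((inner ℝ (c x) (c y) : ℝ) : ℂ) :=
  exists_feature_map (integrable_sharpPropagatorFourier hk_int a hb)
    (sharpPropagatorFourier_nonneg hk_pos a b) (sharpPropagatorFourier_neg hk_even a b)

theorem exists_isSharpFreeMeasure (hk_even : ∀ p, k (-p) = k p) (hk_pos : ∀ᵐ p, 0 < k p)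
    (hk_int : LocallyIntegrable (fun p => (k p)⁻¹)) (a : ℝ) {b : ℝ} (hb : 0 ≤ b) :
    ∃ μ, IsSharpFreeMeasure k a b μ := by
  obtain ⟨c, hc, ⟨C, hC⟩, hK⟩ := exists_feature_map_sharpPropagator hk_even hk_pos hk_int a hb
  obtain ⟨μ, hμ, h⟩ := exists_gaussian_field hc hC
  refine ⟨μ, hμ, fun f => ?_⟩
  rw [h, sharpInverseForm]
  simp_rw [hK]
  rw [integral_integral_inner_mul hc hC]

theorem isSharpFreeMeasure_sharpFreeMeasure (hk_even : ∀ p, k (-p) = k p)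
    (hk_pos : ∀ᵐ p, 0 < k p) (hk_int : LocallyIntegrable (fun p => (k p)⁻¹)) (a : ℝ) {b : ℝ}
    (hb : 0 ≤ b) : IsSharpFreeMeasure k a b (sharpFreeMeasure k a b) := by
  have h := exists_isSharpFreeMeasure hk_even hk_pos hk_int a hb
  rw [sharpFreeMeasure, dif_pos h]
  exact h.choose_spec

theorem IsSharpFreeMeasure.unique {a b : ℝ} {μ ν : Measure (FieldSpace E)}
    (hμ : IsSharpFreeMeasure k a b μ) (hν : IsSharpFreeMeasure k a b ν) : μ = ν := by
  have := hμ.1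
  have := hν.1
  exact ext_of_charFunctional fun f => (hμ.2 f).trans (hν.2 f).symm

/-- The iterated integral in `sharpInverseForm` converges absolutely at both stages. -/
theorem integrable_sharpInverseForm_integrands (hk_even : ∀ p, k (-p) = k p)
    (hk_pos : ∀ᵐ p, 0 < k p) (hk_int : LocallyIntegrable (fun p => (k p)⁻¹)) (a : ℝ) {b : ℝ}
    (hb : 0 ≤ b) (f : 𝓢(E, ℝ)) :
    (∀ x, Integrable (fun y => sharpPropagator k a b x y * (f x : ℂ) * (f y : ℂ)) (nu E)) ∧
      Integrable (fun x => ∫ y, sharpPropagator k a b x y * (f x : ℂ) * (f y : ℂ) ∂(nu E))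
        (nu E) := by
  obtain ⟨c, hc, ⟨C, hC⟩, hK⟩ := exists_feature_map_sharpPropagator hk_even hk_pos hk_int a hb
  have hi := integrable_smul_of_bounded hc hC f
  have h1 (x y : E) : sharpPropagator k a b x y * (f x : ℂ) * (f y : ℂ) =
      ((inner ℝ (f x • c x) (f y • c y) : ℝ) : ℂ) := by
    rw [hK, real_inner_smul_left, real_inner_smul_right]
    push_cast
    ring
  simp_rw [h1]
  refine ⟨fun x => (hi.const_inner (𝕜 := ℝ) (f x • c x)).ofReal, ?_⟩
  simp_rw [integral_complex_ofReal, integral_inner hi]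
  exact (hi.inner_const (𝕜 := ℝ) _).ofReal

theorem sharpInverseForm_add [Nontrivial E] (hk_even : ∀ p, k (-p) = k p)
    (hk_pos : ∀ᵐ p, 0 < k p) (hk_int : LocallyIntegrable (fun p => (k p)⁻¹)) {a b c : ℝ}
    (ha : 0 ≤ a) (hab : a ≤ b) (hbc : b ≤ c) (f : 𝓢(E, ℝ)) :
    sharpInverseForm k a c f = sharpInverseForm k a b f + sharpInverseForm k b c f := by
  have h1 := integrable_sharpInverseForm_integrands hk_even hk_pos hk_int a (ha.trans hab) f
  have h2 := integrable_sharpInverseForm_integrands hk_even hk_pos hk_int b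
    ((ha.trans hab).trans hbc) f
  simp only [sharpInverseForm]
  rw [← integral_add h1.2 h2.2]
  refine integral_congr_ae (.of_forall fun x => ?_)
  beta_reduce
  rw [← integral_add (h1.1 x) (h2.1 x)]
  simp only [sharpPropagator_add hk_int ha hab hbc, add_mul]

/-- The convolution of the free measures of two adjacent shells is the free measure of their union,
because the inverse forms add up. -/
theorem IsSharpFreeMeasure.conv [Nontrivial E] (hk_even : ∀ p, k (-p) = k p)
    (hk_pos : ∀ᵐ p, 0 < k p) (hk_int : LocallyIntegrable (fun p => (k p)⁻¹)) {a b c : ℝ}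
    (ha : 0 ≤ a) (hab : a ≤ b) (hbc : b ≤ c) {μ ν : Measure (FieldSpace E)}
    (hμ : IsSharpFreeMeasure k a b μ) (hν : IsSharpFreeMeasure k b c ν) :
    IsSharpFreeMeasure k a c (μ.conv ν) := by
  have := hμ.1
  have := hν.1
  refine ⟨inferInstance, fun f => ?_⟩
  rw [charFunctional_conv, hμ.2, hν.2, ← exp_add, ← mul_add,
    sharpInverseForm_add hk_even hk_pos hk_int ha hab hbc]

end FreeMeasure

end EuclideanQFT

end

theorem mainTheorem1 {E : Type*} [NormedAddCommGroup E] [InnerProductSpace ℝ E]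
    [FiniteDimensional ℝ E] [Nontrivial E] [MeasurableSpace E] [BorelSpace E]
    (k : E → ℝ) (hk_even : ∀ p, k (-p) = k p) (hk_pos : ∀ᵐ p, 0 < k p)
    (hk_int : LocallyIntegrable (fun p => (k p)⁻¹))
    (Λ Λ' : ℝ) (hΛ : 0 ≤ Λ) (hΛΛ' : Λ ≤ Λ') :
    (∀ a b : ℝ, 0 ≤ a → a ≤ b →
      EuclideanQFT.IsSharpFreeMeasure k a b (EuclideanQFT.sharpFreeMeasure k a b) ∧
        ∀ μ, EuclideanQFT.IsSharpFreeMeasure k a b μ → μ = EuclideanQFT.sharpFreeMeasure k a b) ∧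
    EuclideanQFT.sharpFreeMeasure k 0 Λ' =
      (EuclideanQFT.sharpFreeMeasure k 0 Λ).conv (EuclideanQFT.sharpFreeMeasure k Λ Λ') := by
  have hfree {a b : ℝ} (ha : 0 ≤ a) (hab : a ≤ b) :=
    EuclideanQFT.isSharpFreeMeasure_sharpFreeMeasure hk_even hk_pos hk_int a (ha.trans hab)
  refine ⟨fun a b ha hab => ⟨hfree ha hab, fun μ hμ => hμ.unique (hfree ha hab)⟩, ?_⟩
  exact (hfree le_rfl (hΛ.trans hΛΛ')).unique (EuclideanQFT.IsSharpFreeMeasure.conv hk_even hk_pos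
    hk_int le_rfl hΛ hΛΛ' (hfree le_rfl hΛ) (hfree hΛ hΛΛ'))
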